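/- Let $k$ be an algebraically closed field of characteristic zero and let $R=k[[x_1,\dots,x_n]]\subseteq k[[t]]$, $n\ge 2$, be the ring of all power series in $x_j=\alpha_jt^{a_j}$, where $\alpha_1,\dots,\alpha_n$ are units of $k[[t]]$ and $1\le a_1<a_2<\dots<a_n$. Assume that $R$ has embedding dimension $n$ and that its integral closure is $\overline R=k[[t]]$, and let $(t^{c_R})k[[t]]$ be the conductor of $R$, i.e. the largest ideal of $k[[t]]$ contained in $R$. For a unit $\alpha=\sum_{j\ge0}u_jt^j$ of $k[[t]]$ put $o(\alpha)=\operatorname{ord}(\alpha-u_0)=\min\{j\ge1: u_j\ne0\}$, with $o(\alpha)=\infty$ if $\alpha\in k$. Let $I$ be the kernel of $k[[X_1,\dots,X_n]]\to R$, $X_j\mapsto x_j$, let $\Omega_R$ be the universally finite module of differentials, i.e. the cokernel of the Jacobian matrix $R^m\to R^n$ of a finite generating set $f_1,\dots,f_m$ of $I$, and let $\tau(\Omega_R)$ be its torsion submodule. Suppose there are indices $i,d$ with $o(\alpha_d)<\infty$ and $o(\alpha_d)+a_i\ge c_R$, and suppose that $o(\alpha_e)\ge o(\alpha_d)$ for some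 index $e\ne d$. (The last condition holds automatically if the presentation is normalized so that $\alpha_1=1$, which can always be achieved by a change of the uniformizer $t$; it also holds automatically in case (1) below if $i\ne d$.) If 1. $o(\alpha_d)\le o(\alpha_i)<\infty$, or 2. $d\ge i$, then $\tau(\Omega_R)\neq0$. -/

import Mathlib

open PowerSeries

noncomputable section

namespace AnalyticCurve

variable {k : Type*} [Field k]

/-- The elements `x_j = α_j t ^ (a_j)` of `k⟦t⟧`. -/
def gen {n : ℕ} (α : Fin n → k⟦X⟧) (a : Fin n → ℕ) (j : Fin n) : k⟦X⟧ :=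
  α j * X ^ a j

theorem constantCoeff_gen {n : ℕ} (α : Fin n → k⟦X⟧) (a : Fin n → ℕ) (ha : ∀ j, 0 < a j)
    (j : Fin n) : PowerSeries.constantCoeff (gen α a j) = 0 := by
  simp [gen, (ha j).ne']

theorem hasSubst_gen {n : ℕ} (α : Fin n → k⟦X⟧) (a : Fin n → ℕ) (ha : ∀ j, 0 < a j) :
    MvPowerSeries.HasSubst (gen α a) :=
  MvPowerSeries.hasSubst_of_constantCoeff_zero (constantCoeff_gen α a ha)

/-- The substitution homomorphism `Φ : k⟦X_1, …, X_n⟧ → k⟦t⟧`, `X_j ↦ x_j`. -/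
def Phi {n : ℕ} {x : Fin n → k⟦X⟧} (hx : MvPowerSeries.HasSubst x) :
    MvPowerSeries (Fin n) k →ₐ[k] k⟦X⟧ :=
  MvPowerSeries.substAlgHom hx

/-- The ring `R = k⟦x_1, …, x_n⟧ ⊆ k⟦t⟧`: all power series in `x_1, …, x_n`. -/
abbrev curveRing {n : ℕ} {x : Fin n → k⟦X⟧} (hx : MvPowerSeries.HasSubst x) : Subalgebra k k⟦X⟧ :=
  (Phi hx).range

instance {n : ℕ} {x : Fin n → k⟦X⟧} (hx : MvPowerSeries.HasSubst x) : IsLocalRing (curveRing hx) :=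
  IsLocalRing.of_surjective' (Phi hx).rangeRestrict.toRingHom (Phi hx).rangeRestrict_surjective

/-- The embedding dimension: the minimal number of generators of the maximal ideal. -/
def embDim (R : Type*) [CommRing R] [IsLocalRing R] : ℕ :=
  (IsLocalRing.maximalIdeal R).spanFinrank

/-- The defining ideal `I = ker Φ`, so that `R ≅ k⟦X_1, …, X_n⟧ / I`. -/
def definingIdeal {n : ℕ} {x : Fin n → k⟦X⟧} (hx : MvPowerSeries.HasSubst x) :
    Ideal (MvPowerSeries (Fin n) k) :=
  RingHom.ker (Phi hx)

/-- The column `(∂f/∂X_1, …, ∂f/∂X_n)` of the Jacobian matrix, with entries read in `R`. -/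
def jacobianColumn {n : ℕ} {x : Fin n → k⟦X⟧} (hx : MvPowerSeries.HasSubst x)
    (f : MvPowerSeries (Fin n) k) : Fin n → curveRing hx :=
  fun j => (Phi hx).rangeRestrict (MvPowerSeries.pderiv k j f)

/-- The submodule of `R ^ n` spanned by the Jacobian columns of the elements of `I`. By the
Leibniz rule it is the image of the Jacobian matrix of any generating set of `I`. -/
def jacobianImage {n : ℕ} {x : Fin n → k⟦X⟧} (hx : MvPowerSeries.HasSubst x) :
    Submodule (curveRing hx) (Fin n → curveRing hx) :=
  Submodule.span (curveRing hx) (jacobianColumn hx '' (definingIdeal hx : Set (MvPowerSeries (Fin n) k)))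

/-- The universally finite module of differentials `Ω_R`: the cokernel of the Jacobian matrix. -/
abbrev Omega {n : ℕ} {x : Fin n → k⟦X⟧} (hx : MvPowerSeries.HasSubst x) : Type _ :=
  (Fin n → curveRing hx) ⧸ jacobianImage hx

/-- The conductor of a subring `R` of `k⟦t⟧`: all `f` with `f k⟦t⟧ ⊆ R`. It is the
largest ideal of `k⟦t⟧` contained in `R`. -/
def conductor (R : Subalgebra k k⟦X⟧) : Ideal k⟦X⟧ where
  carrier := {f | ∀ g : k⟦X⟧, f * g ∈ R}
  add_mem' hf hg h := by rw [add_mul]; exact R.add_mem (hf h) (hg h)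
  zero_mem' h := by rw [zero_mul]; exact R.zero_mem
  smul_mem' c f hf h := by
    rw [smul_eq_mul, mul_comm c f, mul_assoc]; exact hf (c * h)

/-- `o(α)`, the order of `α` minus its constant term; it is `⊤` iff `α` is constant. -/
def unitOrder (α : k⟦X⟧) : ℕ∞ :=
  (α - PowerSeries.C (PowerSeries.constantCoeff α)).order

end AnalyticCurve

end

/-! Assume `Ω_R` is torsion-free. The map `Ω_R → k⟦t⟧`, `dF ↦ dF/dt`, has torsion kernel
(`mkQ_mem_torsion`), so every relation `∑ F_j dx_j/dt = 0` over `R` comes from gradients of elements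
of `I`. Since the embedding dimension is `n`, elements of `I` have no linear terms
(`coeff_single_eq_zero`). Their gradients therefore vanish at the origin and have a symmetric matrix
of linear coefficients (the Hessian), and both properties survive `R`-linear combinations and
changes of lift. So every syzygy is symmetric to first order
(`isSymmetricSystem_of_torsion_eq_bot`).

A syzygy violating this is then built. With `t dx_j/dt = t^(a_j) β_j`, the vector with `a_q x_q` in
place `p` and `-a_p x_p` in place `q` is a syzygy up to an error governed by `α_p'` and `α_q'`. If
both units are constant to high enough order, the error is absorbed by a conductor element `r` in
place `q`. Symmetry would force the coefficient of `X_p` in `r` to be `-(a_p + a_q) ≠ 0`, whereas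
lifts of conductor elements have no such linear term (`coeff_eq_zero_of_three_le`,
`coeff_one_eq_zero`, or a comparison of orders). The two cases of the theorem differ only in the
choice of `p` and `q`. -/

noncomputable section

namespace AnalyticCurve

/-! ### Substitution homomorphisms and chain rules -/

section

/-- Every power series is its constant term plus a combination of the variables. -/
theorem exists_eq_C_add_sum_X_mul {R : Type*} [CommRing R] {n : ℕ}
    (F : MvPowerSeries (Fin n) R) :
    ∃ G : Fin n → MvPowerSeries (Fin n) R,
      F = MvPowerSeries.C (MvPowerSeries.constantCoeff F) + ∑ j, MvPowerSeries.X j * G j := by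
  classical
  have hex : ∀ e : Fin n →₀ ℕ, e ≠ 0 → ∃ j, e j ≠ 0 := fun e he => Finsupp.ne_iff.mp he
  -- Each nonconstant monomial is assigned to a single variable dividing it, so that it is counted
  -- once in the sum.
  let v : (Fin n →₀ ℕ) → Option (Fin n) := fun e =>
    if h : e = 0 then none else some (hex e h).choose
  refine ⟨fun j e => if v (e + Finsupp.single j 1) = some j then
    MvPowerSeries.coeff (e + Finsupp.single j 1) F else 0, ?_⟩
  ext e
  have key : ∀ j, MvPowerSeries.coeff e (MvPowerSeries.X j *
      (show MvPowerSeries (Fin n) R from fun e => if v (e + Finsupp.single j 1) = some j then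
        MvPowerSeries.coeff (e + Finsupp.single j 1) F else 0)) =
      if v e = some j then MvPowerSeries.coeff e F else 0 := by
    intro j
    rw [MvPowerSeries.X, MvPowerSeries.coeff_monomial_mul]
    by_cases hj : Finsupp.single j 1 ≤ e
    · rw [if_pos hj, one_mul]
      change (if v (e - Finsupp.single j 1 + Finsupp.single j 1) = some j then
        MvPowerSeries.coeff (e - Finsupp.single j 1 + Finsupp.single j 1) F else 0) = _
      rw [tsub_add_cancel_of_le hj]
    · rw [if_neg hj, if_neg]
      intro hv
      apply hj
      by_cases h0 : e = 0
      · simp [v, h0] at hv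
      · simp only [v, h0, dite_false, Option.some.injEq] at hv
        have := (hex e h0).choose_spec
        rw [hv] at this
        rw [Finsupp.single_le_iff]
        omega
  rw [map_add, map_sum]
  erw [Finset.sum_congr rfl fun j _ => key j]
  rw [MvPowerSeries.coeff_C]
  by_cases h0 : e = 0
  · simp [h0, v]
  · simp [h0, v]

theorem eq_zero_of_forall_X_pow_dvd {R : Type*} [CommRing R] {f : R⟦X⟧}
    (h : ∀ K, (PowerSeries.X : R⟦X⟧) ^ K ∣ f) : f = 0 := by
  ext m
  exact PowerSeries.X_pow_dvd_iff.mp (h (m + 1)) m (Nat.lt_succ_self m)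

variable {k : Type*} [Field k] {n : ℕ} {x : Fin n → k⟦X⟧}

@[simp]
theorem Phi_X (hx : MvPowerSeries.HasSubst x) (j : Fin n) :
    Phi hx (MvPowerSeries.X j) = x j :=
  MvPowerSeries.substAlgHom_X hx j

@[simp]
theorem Phi_C (hx : MvPowerSeries.HasSubst x) (c : k) :
    Phi hx (MvPowerSeries.C c) = PowerSeries.C c := by
  exact (Phi hx).commutes c

theorem constantCoeff_Phi (hx : MvPowerSeries.HasSubst x)
    (hx0 : ∀ j, PowerSeries.constantCoeff (x j) = 0) (F : MvPowerSeries (Fin n) k) :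
    PowerSeries.constantCoeff (Phi hx F) = MvPowerSeries.constantCoeff F := by
  obtain ⟨G, hG⟩ := exists_eq_C_add_sum_X_mul F
  conv_lhs => rw [hG]
  simp [hx0]

/-- The chain rule for `Phi`. -/
theorem derivative_Phi (hx : MvPowerSeries.HasSubst x)
    (hx0 : ∀ j, PowerSeries.constantCoeff (x j) = 0) (F : MvPowerSeries (Fin n) k) :
    d⁄dX k (Phi hx F) = ∑ j, Phi hx (MvPowerSeries.pderiv k j F) * d⁄dX k (x j) := by
  classical
  rw [← sub_eq_zero]
  refine eq_zero_of_forall_X_pow_dvd fun K => ?_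
  induction K generalizing F with
  | zero => simp
  | succ K ih =>
    obtain ⟨G, hG⟩ := exists_eq_C_add_sum_X_mul F
    -- The defect of the chain rule for `F` is `∑ x_l` times the defects for the `G l`. Each `x_l`
    -- is divisible by `t`, so iterating makes the defect divisible by every power of `t`.
    have hsum : d⁄dX k (Phi hx F) - ∑ j, Phi hx (MvPowerSeries.pderiv k j F) * d⁄dX k (x j) =
        ∑ l, x l * (d⁄dX k (Phi hx (G l)) -
          ∑ j, Phi hx (MvPowerSeries.pderiv k j (G l)) * d⁄dX k (x j)) := by
      have h1 : d⁄dX k (Phi hx F) =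
          ∑ l, (x l * d⁄dX k (Phi hx (G l)) + Phi hx (G l) * d⁄dX k (x l)) := by
        conv_lhs => rw [hG]
        simp [smul_eq_mul]
      have h2 : ∀ j, Phi hx (MvPowerSeries.pderiv k j F) =
          ∑ l, x l * Phi hx (MvPowerSeries.pderiv k j (G l)) + Phi hx (G j) := by
        intro j
        conv_lhs => rw [hG]
        simp only [map_add, MvPowerSeries.pderiv_C, map_sum, Derivation.leibniz,
          smul_eq_mul, map_mul, Phi_X, zero_add, Finset.sum_add_distrib,
          MvPowerSeries.pderiv_X]
        congr 1
        rw [Finset.sum_eq_single j]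
        · simp
        · intro b _ hb; simp [hb]
        · simp
      simp only [h1, h2, add_mul, Finset.sum_add_distrib, mul_sub, Finset.sum_sub_distrib,
        Finset.sum_mul, Finset.mul_sum]
      rw [Finset.sum_comm]
      simp only [mul_assoc]
      ring
    rw [hsum]
    refine Finset.dvd_sum fun l _ => ?_
    rw [pow_succ']
    exact mul_dvd_mul (PowerSeries.X_dvd_iff.mpr (hx0 l)) (ih (G l))

theorem eq_C_add_X_mul {R : Type*} [CommRing R] (g : R⟦X⟧) :
    ∃ h : R⟦X⟧, g = PowerSeries.C (PowerSeries.constantCoeff g) + PowerSeries.X * h := by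
  obtain ⟨h, hh⟩ := PowerSeries.X_dvd_iff.mpr
    (show PowerSeries.constantCoeff (g - PowerSeries.C (PowerSeries.constantCoeff g)) = 0 by simp)
  exact ⟨h, by rw [← hh]; ring⟩

/-- The chain rule for the composite of a power series in one variable with a power series in
several variables, read in `k⟦t⟧`. -/
theorem Phi_pderiv_subst (hx : MvPowerSeries.HasSubst x)
    (hx0 : ∀ j, PowerSeries.constantCoeff (x j) = 0) {U : MvPowerSeries (Fin n) k}
    (hU : MvPowerSeries.constantCoeff U = 0) (g : k⟦X⟧) (j : Fin n) :
    Phi hx (MvPowerSeries.pderiv k j (g.subst U)) =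
      Phi hx ((d⁄dX k g).subst U) * Phi hx (MvPowerSeries.pderiv k j U) := by
  have hs : PowerSeries.HasSubst U := PowerSeries.HasSubst.of_constantCoeff_zero hU
  rw [← sub_eq_zero]
  refine eq_zero_of_forall_X_pow_dvd fun K => ?_
  induction K generalizing g with
  | zero => simp
  | succ K ih =>
    obtain ⟨h, hh⟩ := eq_C_add_X_mul g
    have hsub : g.subst U = MvPowerSeries.C (PowerSeries.constantCoeff g) + U * h.subst U := by
      conv_lhs => rw [hh]
      rw [PowerSeries.subst_add hs, PowerSeries.subst_mul hs, PowerSeries.subst_X hs,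
        PowerSeries.subst_C]
    have hd : (d⁄dX k g).subst U = h.subst U + U * (d⁄dX k h).subst U := by
      conv_lhs => rw [hh]
      simp only [map_add, PowerSeries.derivative_C, Derivation.leibniz, PowerSeries.derivative_X,
        smul_eq_mul, zero_add, mul_one]
      rw [PowerSeries.subst_add hs, PowerSeries.subst_mul hs, PowerSeries.subst_X hs, add_comm]
    have : Phi hx (MvPowerSeries.pderiv k j (g.subst U)) -
        Phi hx ((d⁄dX k g).subst U) * Phi hx (MvPowerSeries.pderiv k j U) =
        Phi hx U * (Phi hx (MvPowerSeries.pderiv k j (h.subst U)) -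
        Phi hx ((d⁄dX k h).subst U) * Phi hx (MvPowerSeries.pderiv k j U)) := by
      rw [hsub, hd]
      simp only [map_add, MvPowerSeries.pderiv_C, Derivation.leibniz, smul_eq_mul, map_mul,
        map_zero]
      ring
    rw [this, pow_succ']
    exact mul_dvd_mul (PowerSeries.X_dvd_iff.mpr (by rw [constantCoeff_Phi hx hx0, hU])) (ih h)

theorem Phi_subst (hx : MvPowerSeries.HasSubst x) {U : MvPowerSeries (Fin n) k}
    (hU : MvPowerSeries.constantCoeff U = 0) (g : k⟦X⟧) :
    Phi hx (g.subst U) = g.subst (Phi hx U) := by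
  have hs : PowerSeries.HasSubst U := PowerSeries.HasSubst.of_constantCoeff_zero hU
  change MvPowerSeries.substAlgHom hx _ = PowerSeries.subst (MvPowerSeries.substAlgHom hx U) g
  rw [MvPowerSeries.substAlgHom_apply, MvPowerSeries.substAlgHom_apply]
  exact MvPowerSeries.subst_comp_subst_apply hs.const hx g

/-- Sorting exponents by their residue modulo `N`. -/
theorem exists_eq_sum_subst_X_pow_mul {R : Type*} [CommRing R] {N : ℕ} (hN : N ≠ 0) (f : R⟦X⟧) :
    ∃ g : ℕ → R⟦X⟧, f = ∑ m ∈ Finset.range N,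
      (g m).subst ((PowerSeries.X : R⟦X⟧) ^ N) * PowerSeries.X ^ m := by
  refine ⟨fun m => PowerSeries.mk fun q => PowerSeries.coeff (N * q + m) f, ?_⟩
  ext e
  have hNpos := Nat.pos_of_ne_zero hN
  rw [map_sum, Finset.sum_eq_single (e % N)]
  · rw [PowerSeries.coeff_mul_X_pow', if_pos (Nat.mod_le _ _), PowerSeries.coeff_subst_X_pow hN,
      if_pos (Nat.dvd_sub_mod e)]
    simp [Nat.mul_div_cancel' (Nat.dvd_sub_mod e), Nat.sub_add_cancel (Nat.mod_le e N)]
  · intro m hm hne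
    rw [PowerSeries.coeff_mul_X_pow']
    split_ifs with hme
    · rw [PowerSeries.coeff_subst_X_pow hN, if_neg]
      rintro ⟨q, hq⟩
      apply hne
      rw [show e = m + N * q by omega, Nat.add_mul_mod_self_left,
        Nat.mod_eq_of_lt (Finset.mem_range.mp hm)]
    · rfl
  · intro h
    exact absurd (Finset.mem_range.mpr (Nat.mod_lt _ hNpos)) h

end

/-! ### The kernel of `Ω_R → k⟦t⟧` is torsion -/

section

theorem mul_smul_mem_of_smul_add_smul_eq {R M : Type*} [CommRing R] [AddCommGroup M] [Module R M]
    (S : Submodule R M) {A u v : R} {y w δ : M} (h : u • y + v • δ = w) (hδ : δ ∈ S)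
    (hw : A • w ∈ S) : (A * u) • y ∈ S := by
  have : (A * u) • y = A • w - (A * v) • δ := by rw [← h]; module
  rw [this]
  exact S.sub_mem hw (S.smul_mem _ hδ)

theorem smul_add_smul_smul_mem {R M : Type*} [CommRing R] [AddCommGroup M] [Module R M]
    (S : Submodule R M) {A : R} {y δ : M} (hy : A • y ∈ S) (hδ : δ ∈ S) (u v w : R) :
    A • (u • y + v • w • δ) ∈ S := by
  have : A • (u • y + v • w • δ) = u • A • y + (A * v * w) • δ := by module
  rw [this]
  exact S.add_mem (S.smul_mem _ hy) (S.smul_mem _ hδ)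

theorem smul_sum_smul_mem {R M ι : Type*} [CommRing R] [AddCommGroup M] [Module R M]
    (S : Submodule R M) {A : R} (s : Finset ι) (z : ι → R) {y : ι → M} (hy : ∀ i, A • y i ∈ S) :
    A • ∑ i ∈ s, z i • y i ∈ S := by
  rw [Finset.smul_sum]
  refine S.sum_mem fun i _ => ?_
  rw [smul_comm]
  exact S.smul_mem _ (hy i)

variable {k : Type*} [Field k] {n : ℕ} {x : Fin n → k⟦X⟧}

/-- The differential `F ↦ dF` with values in `Ω_R`. -/
def differential (hx : MvPowerSeries.HasSubst x) (F : MvPowerSeries (Fin n) k) : Omega hx :=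
  (jacobianImage hx).mkQ (jacobianColumn hx F)

theorem differential_add (hx : MvPowerSeries.HasSubst x) (F G : MvPowerSeries (Fin n) k) :
    differential hx (F + G) = differential hx F + differential hx G := by
  rw [differential, differential, differential, ← map_add]
  congr 1
  ext j
  simp [jacobianColumn]

theorem differential_sum (hx : MvPowerSeries.HasSubst x) {ι : Type*} (s : Finset ι)
    (F : ι → MvPowerSeries (Fin n) k) :
    differential hx (∑ i ∈ s, F i) = ∑ i ∈ s, differential hx (F i) := by
  classical
  induction s using Finset.induction_on with
  | empty =>
    rw [Finset.sum_empty, Finset.sum_empty, differential]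
    rw [show jacobianColumn hx 0 = 0 by ext j; simp [jacobianColumn], map_zero]
  | insert i s hi ih => rw [Finset.sum_insert hi, Finset.sum_insert hi, differential_add, ih]

theorem differential_mul (hx : MvPowerSeries.HasSubst x) (F G : MvPowerSeries (Fin n) k) :
    differential hx (F * G) = (Phi hx).rangeRestrict F • differential hx G +
      (Phi hx).rangeRestrict G • differential hx F := by
  rw [differential, differential, differential, ← map_smul, ← map_smul, ← map_add]
  congr 1
  ext j
  simp [jacobianColumn]

theorem differential_pow (hx : MvPowerSeries.HasSubst x) (F : MvPowerSeries (Fin n) k) (m : ℕ) :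
    differential hx (F ^ (m + 1)) =
      ((m + 1 : ℕ) * (Phi hx).rangeRestrict F ^ m) • differential hx F := by
  induction m with
  | zero => simp
  | succ m ih =>
    rw [pow_succ F (m + 1), differential_mul, ih, smul_smul, ← add_smul, map_pow]
    congr 1
    push_cast
    ring

/-- The difference of two lifts lies in `I`, so its gradient is one of the generators of the
Jacobian image. Identities in `k⟦t⟧` can thus be differentiated in `Ω_R` through any choice of
lifts. -/
theorem differential_congr (hx : MvPowerSeries.HasSubst x) {F G : MvPowerSeries (Fin n) k}
    (h : Phi hx F = Phi hx G) : differential hx F = differential hx G := by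
  rw [differential, differential, ← sub_eq_zero, ← map_sub, Submodule.mkQ_apply,
    Submodule.Quotient.mk_eq_zero]
  refine Submodule.subset_span ⟨F - G, ?_, ?_⟩
  · simp [definingIdeal, RingHom.mem_ker, h]
  · ext j
    simp [jacobianColumn]

theorem differential_subst (hx : MvPowerSeries.HasSubst x)
    (hx0 : ∀ j, PowerSeries.constantCoeff (x j) = 0) {U : MvPowerSeries (Fin n) k}
    (hU : MvPowerSeries.constantCoeff U = 0) (g : k⟦X⟧) :
    differential hx (g.subst U) =
      (Phi hx).rangeRestrict ((d⁄dX k g).subst U) • differential hx U := by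
  rw [differential, differential, ← map_smul]
  congr 1
  ext1 j
  apply Subtype.ext
  exact Phi_pderiv_subst hx hx0 hU g j

theorem mkQ_eq_sum_smul_differential (hx : MvPowerSeries.HasSubst x)
    (z : Fin n → curveRing hx) :
    (jacobianImage hx).mkQ z = ∑ j, z j • differential hx (MvPowerSeries.X j) := by
  classical
  simp only [differential, ← map_smul, ← map_sum]
  congr 1
  ext l
  simp [jacobianColumn, MvPowerSeries.pderiv_X, Pi.single_apply, apply_ite]

/-- The map `Ω_R → k⟦t⟧`, `dF ↦ dF/dt`. -/
def omegaToPowerSeries (hx : MvPowerSeries.HasSubst x)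
    (hx0 : ∀ j, PowerSeries.constantCoeff (x j) = 0) : Omega hx →ₗ[curveRing hx] k⟦X⟧ :=
  (jacobianImage hx).liftQ
    (∑ j, (LinearMap.toSpanSingleton (curveRing hx) k⟦X⟧ (d⁄dX k (x j))).comp
      (LinearMap.proj j)) (by
    rw [jacobianImage, Submodule.span_le]
    rintro _ ⟨f, hf, rfl⟩
    have h := derivative_Phi hx hx0 f
    rw [show Phi hx f = 0 from hf, map_zero] at h
    simp only [SetLike.mem_coe, LinearMap.mem_ker, LinearMap.sum_apply, LinearMap.comp_apply,
      LinearMap.proj_apply, LinearMap.toSpanSingleton_apply]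
    exact h.symm)

theorem omegaToPowerSeries_mkQ (hx : MvPowerSeries.HasSubst x)
    (hx0 : ∀ j, PowerSeries.constantCoeff (x j) = 0) (z : Fin n → curveRing hx) :
    omegaToPowerSeries hx hx0 ((jacobianImage hx).mkQ z) =
      ∑ j, (z j : k⟦X⟧) * d⁄dX k (x j) := by
  simp only [omegaToPowerSeries, Submodule.mkQ_apply, Submodule.liftQ_apply, LinearMap.sum_apply,
    LinearMap.comp_apply, LinearMap.proj_apply, LinearMap.toSpanSingleton_apply]
  rfl

theorem omegaToPowerSeries_differential (hx : MvPowerSeries.HasSubst x)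
    (hx0 : ∀ j, PowerSeries.constantCoeff (x j) = 0) (F : MvPowerSeries (Fin n) k) :
    omegaToPowerSeries hx hx0 (differential hx F) = d⁄dX k (Phi hx F) := by
  rw [differential, omegaToPowerSeries_mkQ, derivative_Phi hx hx0]
  rfl

variable [CharZero k]

/-- If `R` contains `t ^ c k⟦t⟧`, then all differentials are multiples of `d(t ^ N)`, up to a
common factor. -/
theorem exists_smul_differential_mem_span (hx : MvPowerSeries.HasSubst x)
    (hx0 : ∀ j, PowerSeries.constantCoeff (x j) = 0) {c : ℕ}
    (hcond : ∀ g : k⟦X⟧, PowerSeries.X ^ c * g ∈ curveRing hx) :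
    ∃ (D : curveRing hx) (U : MvPowerSeries (Fin n) k) (N : ℕ), D ≠ 0 ∧ N ≠ 0 ∧
      Phi hx U = PowerSeries.X ^ N ∧
      ∀ F, D • differential hx F ∈ Submodule.span (curveRing hx) {differential hx U} := by
  have hpow : ∀ m, c ≤ m → ∃ V, Phi hx V = PowerSeries.X ^ m := by
    intro m hm
    obtain ⟨V, hV⟩ := hcond (PowerSeries.X ^ (m - c))
    exact ⟨V, by rw [← pow_add, Nat.add_sub_cancel' hm] at hV; exact hV⟩
  set N := c + 1 with hN
  obtain ⟨U, hU⟩ := hpow N (by omega)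
  have hV' : ∀ m, ∃ V, Phi hx V = PowerSeries.X ^ (N + m) := fun m => hpow _ (by omega)
  choose V hV using hV'
  have hU0 : MvPowerSeries.constantCoeff U = 0 := by
    rw [← constantCoeff_Phi hx hx0, hU]; simp [hN]
  -- The exponent is large enough that dividing by `t^((N+m)c)`, for any `m < N`, still leaves an
  -- exponent at least `c`, hence an element of `R`.
  obtain ⟨E, hE⟩ := hpow (2 * N * N) (by nlinarith)
  set S := Submodule.span (curveRing hx) {differential hx U} with hS
  have hmem : ∀ r : curveRing hx, r • differential hx U ∈ S := fun r =>
    S.smul_mem r (Submodule.mem_span_singleton_self _)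
  set E' : curveRing hx := (Phi hx).rangeRestrict E with hE'
  have hVmem : ∀ m < N, ((N : curveRing hx) * E') • differential hx (V m) ∈ S := by
    intro m hm
    obtain ⟨W, hW⟩ := hpow (2 * N * N - (N + m) * c) (by
      have : (N + m) * c ≤ (N + c) * c := Nat.mul_le_mul_right _ (by omega)
      have : (N + c) * c + c ≤ 2 * N * N := by rw [hN]; nlinarith
      omega)
    have hle : (N + m) * c ≤ 2 * N * N := by
      have : (N + m) * c ≤ (N + c) * c := Nat.mul_le_mul_right _ (by omega)
      have : (N + c) * c + c ≤ 2 * N * N := by rw [hN]; nlinarith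
      omega
    have hEW : E' = (Phi hx).rangeRestrict W * (Phi hx).rangeRestrict (V m) ^ c := by
      apply Subtype.ext
      change Phi hx E = Phi hx W * Phi hx (V m) ^ c
      rw [hE, hW, hV, ← pow_mul, ← pow_add, Nat.sub_add_cancel hle]
    -- Both powers represent `t^(N(N+m))`. Differentiating gives `N V_m^c dV_m = (N+m) U^(N+m-1)
    -- dU`, which makes `dV_m` a multiple of `dU` up to a factor.
    have hpw : differential hx (V m ^ (c + 1)) = differential hx (U ^ (N + m - 1 + 1)) := by
      apply differential_congr
      rw [map_pow, map_pow, hU, hV, ← pow_mul, ← pow_mul]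
      congr 1
      rw [show N + m - 1 + 1 = N + m by omega, mul_comm]
    rw [differential_pow, differential_pow, ← hN] at hpw
    have : ((N : curveRing hx) * E') • differential hx (V m) = (Phi hx).rangeRestrict W •
        (((N : curveRing hx) * (Phi hx).rangeRestrict (V m) ^ c) • differential hx (V m)) := by
      rw [hEW, smul_smul]
      congr 1
      ring
    rw [this, hpw, smul_smul]
    exact hmem _
  refine ⟨(N : curveRing hx) * E' * (Phi hx).rangeRestrict U, U, N, ?_, by omega, hU, fun F => ?_⟩
  · intro h0
    have h0' : ((N : k⟦X⟧)) * Phi hx E * Phi hx U = 0 := congrArg Subtype.val h0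
    rw [hE, hU] at h0'
    have : (N : k⟦X⟧) ≠ 0 := by
      intro h
      have := congrArg PowerSeries.constantCoeff h
      rw [map_natCast, map_zero, hN] at this
      exact Nat.cast_ne_zero.mpr (Nat.succ_ne_zero c) this
    exact (mul_ne_zero (mul_ne_zero this (pow_ne_zero _ PowerSeries.X_ne_zero))
      (pow_ne_zero _ PowerSeries.X_ne_zero)) h0'
  -- Splitting exponents modulo `N` gives `U F = ∑ g_m(U) V_m` in `R`, with finitely many terms. The
  -- product rule then expresses `U dF` through `dU` and the `dV_m`.
  · obtain ⟨g, hg⟩ := exists_eq_sum_subst_X_pow_mul (N := N) (by omega) (Phi hx F)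
    have hUF : differential hx (U * F) =
        differential hx (∑ m ∈ Finset.range N, (g m).subst U * V m) := by
      apply differential_congr
      rw [map_mul, hU, map_sum]
      conv_lhs => rw [hg]
      rw [Finset.mul_sum]
      refine Finset.sum_congr rfl fun m _ => ?_
      rw [map_mul, Phi_subst hx hU0, hU, hV, pow_add]
      ring
    rw [differential_mul] at hUF
    refine mul_smul_mem_of_smul_add_smul_eq S hUF ?_ ?_
    · exact Submodule.mem_span_singleton_self _
    · rw [differential_sum, Finset.smul_sum]
      refine S.sum_mem fun m hm => ?_
      rw [differential_mul, differential_subst hx hx0 hU0]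
      exact smul_add_smul_smul_mem S (hVmem m (Finset.mem_range.mp hm))
        (Submodule.mem_span_singleton_self _) _ _ _

/-- The kernel of `Ω_R → k⟦t⟧` is torsion when `R` contains `t ^ c k⟦t⟧`. -/
theorem mkQ_mem_torsion (hx : MvPowerSeries.HasSubst x)
    (hx0 : ∀ j, PowerSeries.constantCoeff (x j) = 0) {c : ℕ}
    (hcond : ∀ g : k⟦X⟧, PowerSeries.X ^ c * g ∈ curveRing hx) (z : Fin n → curveRing hx)
    (hz : ∑ j, (z j : k⟦X⟧) * d⁄dX k (x j) = 0) :
    (jacobianImage hx).mkQ z ∈ Submodule.torsion (curveRing hx) (Omega hx) := by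
  obtain ⟨D, U, N, hD, hN, hU, hspan⟩ := exists_smul_differential_mem_span hx hx0 hcond
  have hmem : D • (jacobianImage hx).mkQ z ∈
      Submodule.span (curveRing hx) {differential hx U} := by
    rw [mkQ_eq_sum_smul_differential]
    exact smul_sum_smul_mem _ _ _ fun j => hspan _
  obtain ⟨s, hs⟩ := Submodule.mem_span_singleton.mp hmem
  -- In `k⟦t⟧` the relation `s dU = D z` becomes `s N t^(N-1) = 0`, so `s = 0` and `D` kills the
  -- class of `z`.
  have h := congrArg (omegaToPowerSeries hx hx0) hs
  rw [map_smul, map_smul, omegaToPowerSeries_mkQ, hz, smul_zero, omegaToPowerSeries_differential,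
    hU] at h
  have h' : (s : k⟦X⟧) * d⁄dX k ((PowerSeries.X : k⟦X⟧) ^ N) = 0 := h
  have hne : d⁄dX k ((PowerSeries.X : k⟦X⟧) ^ N) ≠ 0 := by
    intro h0
    have := congrArg (PowerSeries.coeff (N - 1)) h0
    rw [PowerSeries.coeff_derivative, Nat.sub_add_cancel (Nat.pos_of_ne_zero hN),
      PowerSeries.coeff_X_pow_self, one_mul, map_zero] at this
    exact Nat.cast_add_one_ne_zero _ this
  have hs0 : s = 0 := Subtype.ext ((mul_eq_zero.mp h').resolve_right hne)
  rw [Submodule.mem_torsion_iff]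
  refine ⟨⟨D, mem_nonZeroDivisors_of_ne_zero hD⟩, ?_⟩
  rw [hs0, zero_smul] at hs
  exact hs.symm

end

/-! ### First-order symmetry of syzygies -/

section

variable {k : Type*} [Field k] {n : ℕ} {x : Fin n → k⟦X⟧}

theorem coe_sum_curveRing (hx : MvPowerSeries.HasSubst x) {ι : Type*} (s : Finset ι)
    (f : ι → curveRing hx) : ((∑ i ∈ s, f i : curveRing hx) : k⟦X⟧) = ∑ i ∈ s, (f i : k⟦X⟧) :=
  map_sum (curveRing hx).val f s

theorem constantCoeff_eq_zero_of_mem_maximalIdeal (hx : MvPowerSeries.HasSubst x)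
    {F : MvPowerSeries (Fin n) k}
    (hF : (Phi hx).rangeRestrict F ∈ IsLocalRing.maximalIdeal (curveRing hx)) :
    MvPowerSeries.constantCoeff F = 0 := by
  by_contra h0
  have hu : IsUnit F := MvPowerSeries.isUnit_iff_constantCoeff.mpr (isUnit_iff_ne_zero.mpr h0)
  exact (IsLocalRing.mem_maximalIdeal _).mp hF (hu.map (Phi hx).rangeRestrict)

theorem rangeRestrict_X_mem_maximalIdeal (hx : MvPowerSeries.HasSubst x)
    (hx0 : ∀ j, PowerSeries.constantCoeff (x j) = 0) (l : Fin n) :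
    (Phi hx).rangeRestrict (MvPowerSeries.X l) ∈ IsLocalRing.maximalIdeal (curveRing hx) := by
  rw [IsLocalRing.mem_maximalIdeal, mem_nonunits_iff]
  intro hu
  have h1 : IsUnit (x l) := by
    have := hu.map (curveRing hx).val
    rwa [show (curveRing hx).val ((Phi hx).rangeRestrict (MvPowerSeries.X l)) = x l from
      Phi_X hx l] at this
  have h2 := h1.map (PowerSeries.constantCoeff (R := k))
  rw [hx0] at h2
  exact not_isUnit_zero h2

theorem coeff_single_X_mul {R : Type*} [CommRing R] [DecidableEq (Fin n)] (l j : Fin n)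
    (G : MvPowerSeries (Fin n) R) :
    MvPowerSeries.coeff (Finsupp.single j 1) (MvPowerSeries.X l * G) =
      if l = j then MvPowerSeries.constantCoeff G else 0 := by
  rw [MvPowerSeries.X, MvPowerSeries.coeff_monomial_mul]
  by_cases h : l = j
  · subst h; simp
  · rw [if_neg, if_neg h]
    intro hle
    rw [Finsupp.single_le_iff, Finsupp.single_apply, if_neg (Ne.symm h)] at hle
    omega

/-- If the embedding dimension is the number of variables, the defining ideal has no linear
terms. -/
theorem coeff_single_eq_zero (hx : MvPowerSeries.HasSubst x)
    (hx0 : ∀ j, PowerSeries.constantCoeff (x j) = 0)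
    (hdim : embDim (curveRing hx) = n) {f : MvPowerSeries (Fin n) k} (hf : Phi hx f = 0)
    (j : Fin n) : MvPowerSeries.coeff (Finsupp.single j 1) f = 0 := by
  classical
  by_contra hj
  have hf0 : MvPowerSeries.constantCoeff f = 0 := by
    rw [← constantCoeff_Phi hx hx0, hf, map_zero]
  obtain ⟨G, hG⟩ := exists_eq_C_add_sum_X_mul f
  rw [hf0, map_zero, zero_add] at hG
  -- A linear term in `X_j` makes `G j` a unit. The relation `∑ x_l G_l = 0` then solves for `x_j`,
  -- and `n - 1` generators suffice for the maximal ideal.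
  have hGj : MvPowerSeries.constantCoeff (G j) ≠ 0 := by
    rw [hG, map_sum, Finset.sum_congr rfl fun l _ => coeff_single_X_mul l j (G l)] at hj
    simpa using hj
  obtain ⟨H, hH⟩ := (MvPowerSeries.isUnit_iff_constantCoeff.mpr
    (isUnit_iff_ne_zero.mpr hGj)).exists_left_inv
  set ξ : Fin n → curveRing hx := fun l => (Phi hx).rangeRestrict (MvPowerSeries.X l) with hξ
  set T : Finset (curveRing hx) := (Finset.univ.erase j).image ξ with hT
  set S : Ideal (curveRing hx) := Ideal.span (T : Set (curveRing hx)) with hS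
  have hne : ∀ l, l ≠ j → ξ l ∈ S := fun l hl => Ideal.subset_span (by
    rw [hT, Finset.coe_image]
    exact ⟨l, by simpa using hl, rfl⟩)
  have hjmem : ξ j ∈ S := by
    have h0 : ∑ l, ξ l * (Phi hx).rangeRestrict (G l) = 0 := by
      apply Subtype.ext
      have h1 : Phi hx (∑ l, MvPowerSeries.X l * G l) = 0 := by rw [← hG, hf]
      rw [coe_sum_curveRing]
      rw [map_sum] at h1
      simp only [map_mul] at h1
      exact h1
    have h1 : ξ j = (Phi hx).rangeRestrict H * (ξ j * (Phi hx).rangeRestrict (G j)) := by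
      rw [mul_left_comm, ← map_mul, hH, map_one, mul_one]
    rw [h1]
    apply S.mul_mem_left
    rw [← Finset.add_sum_erase _ _ (Finset.mem_univ j)] at h0
    rw [eq_neg_of_add_eq_zero_left h0]
    exact S.neg_mem (S.sum_mem fun l hl => S.mul_mem_right _ (hne l (Finset.ne_of_mem_erase hl)))
  have hmax : IsLocalRing.maximalIdeal (curveRing hx) = S := by
    apply le_antisymm
    · intro r hr
      obtain ⟨F, rfl⟩ := (Phi hx).rangeRestrict_surjective r
      have hF0 := constantCoeff_eq_zero_of_mem_maximalIdeal hx hr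
      obtain ⟨G', hG'⟩ := exists_eq_C_add_sum_X_mul F
      rw [hG', hF0, map_zero, zero_add, map_sum]
      refine S.sum_mem fun l _ => ?_
      rw [map_mul]
      apply S.mul_mem_right
      by_cases hl : l = j
      · rw [hl]; exact hjmem
      · exact hne l hl
    · rw [hS, Ideal.span_le]
      intro r hr
      rw [hT, Finset.coe_image] at hr
      obtain ⟨l, _, rfl⟩ := hr
      exact rangeRestrict_X_mem_maximalIdeal hx hx0 l
  have hle : embDim (curveRing hx) ≤ n - 1 := by
    rw [embDim, hmax]
    refine (Submodule.spanFinrank_span_le_ncard_of_finite T.finite_toSet).trans ?_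
    rw [Set.ncard_coe_finset]
    refine Finset.card_image_le.trans ?_
    simp
  have := j.pos
  omega

/-- A system of power series that looks like a gradient to first order: no constant terms, and a
symmetric matrix of linear coefficients. -/
def IsSymmetricSystem (F : Fin n → MvPowerSeries (Fin n) k) : Prop :=
  (∀ j, MvPowerSeries.constantCoeff (F j) = 0) ∧
    ∀ p q, MvPowerSeries.coeff (Finsupp.single q 1) (F p) =
      MvPowerSeries.coeff (Finsupp.single p 1) (F q)

theorem IsSymmetricSystem.add {F G : Fin n → MvPowerSeries (Fin n) k} (hF : IsSymmetricSystem F)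
    (hG : IsSymmetricSystem G) : IsSymmetricSystem (F + G) :=
  ⟨fun j => by simp [hF.1, hG.1], fun p q => by simp [hF.2 p q, hG.2 p q]⟩

theorem coeff_single_mul {R : Type*} [CommRing R] (F G : MvPowerSeries (Fin n) R) (j : Fin n) :
    MvPowerSeries.coeff (Finsupp.single j 1) (F * G) =
      MvPowerSeries.constantCoeff F * MvPowerSeries.coeff (Finsupp.single j 1) G +
      MvPowerSeries.coeff (Finsupp.single j 1) F * MvPowerSeries.constantCoeff G := by
  classical
  obtain ⟨F', hF'⟩ := exists_eq_C_add_sum_X_mul F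
  have h1 : MvPowerSeries.coeff (Finsupp.single j 1) F = MvPowerSeries.constantCoeff (F' j) := by
    conv_lhs => rw [hF']
    rw [map_add, map_sum, Finset.sum_congr rfl fun l _ => coeff_single_X_mul l j (F' l)]
    simp [MvPowerSeries.coeff_C]
  rw [h1]
  conv_lhs => rw [hF']
  rw [add_mul, Finset.sum_mul, map_add, map_sum, MvPowerSeries.coeff_C_mul]
  simp only [mul_assoc]
  rw [Finset.sum_congr rfl fun l _ => coeff_single_X_mul l j (F' l * G)]
  simp

/-- Because the constant terms vanish, the linear part of `g F_p` is `g(0)` times that of `F_p`.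
This is why the definition requires vanishing constant terms. -/
theorem IsSymmetricSystem.smul {F : Fin n → MvPowerSeries (Fin n) k} (hF : IsSymmetricSystem F)
    (g : MvPowerSeries (Fin n) k) : IsSymmetricSystem (g • F) := by
  refine ⟨fun j => by simp [hF.1], fun p q => ?_⟩
  simp only [Pi.smul_apply, smul_eq_mul, coeff_single_mul, hF.1, mul_zero, add_zero, hF.2 p q]

/-- The linear coefficients of the gradient form the Hessian at the origin; its constant terms are
the linear coefficients of `f`. -/
theorem isSymmetricSystem_pderiv {f : MvPowerSeries (Fin n) k}
    (hf : ∀ j, MvPowerSeries.coeff (Finsupp.single j 1) f = 0) :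
    IsSymmetricSystem fun j => MvPowerSeries.pderiv k j f := by
  refine ⟨fun j => ?_, fun p q => ?_⟩
  · rw [← MvPowerSeries.coeff_zero_eq_constantCoeff_apply, MvPowerSeries.coeff_pderiv, zero_add,
      hf, zero_mul]
  · by_cases h : p = q
    · rw [h]
    · rw [MvPowerSeries.coeff_pderiv, MvPowerSeries.coeff_pderiv, add_comm (Finsupp.single q 1),
        Finsupp.single_eq_of_ne h, Finsupp.single_eq_of_ne (Ne.symm h)]

/-- If `Ω_R` is torsion-free, every syzygy of `(dx_1/dt, …, dx_n/dt)` is symmetric to first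
order. -/
theorem isSymmetricSystem_of_torsion_eq_bot [CharZero k] (hx : MvPowerSeries.HasSubst x)
    (hx0 : ∀ j, PowerSeries.constantCoeff (x j) = 0)
    (hdim : embDim (curveRing hx) = n) {c : ℕ}
    (hcond : ∀ g : k⟦X⟧, PowerSeries.X ^ c * g ∈ curveRing hx)
    (htors : Submodule.torsion (curveRing hx) (Omega hx) = ⊥)
    {F : Fin n → MvPowerSeries (Fin n) k} (hF : ∑ j, Phi hx (F j) * d⁄dX k (x j) = 0) :
    IsSymmetricSystem F := by
  set z : Fin n → curveRing hx := fun j => (Phi hx).rangeRestrict (F j) with hz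
  have hmem : z ∈ jacobianImage hx := by
    have h := mkQ_mem_torsion hx hx0 hcond z hF
    rw [htors, Submodule.mem_bot, Submodule.mkQ_apply, Submodule.Quotient.mk_eq_zero] at h
    exact h
  have hlift : ∀ w ∈ jacobianImage hx, ∃ G : Fin n → MvPowerSeries (Fin n) k,
      IsSymmetricSystem G ∧ ∀ j, (Phi hx).rangeRestrict (G j) = w j := by
    intro w hw
    induction hw using Submodule.span_induction with
    | mem w hw =>
      obtain ⟨f, hf, rfl⟩ := hw
      exact ⟨_, isSymmetricSystem_pderiv fun j => coeff_single_eq_zero hx hx0 hdim hf j,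
        fun j => rfl⟩
    | zero => exact ⟨0, ⟨fun j => by simp, fun p q => by simp⟩, fun j => by simp⟩
    | add u v _ _ hu hv =>
      obtain ⟨G, hG, hGu⟩ := hu
      obtain ⟨H, hH, hHv⟩ := hv
      exact ⟨G + H, hG.add hH, fun j => by simp [hGu, hHv]⟩
    | smul r u _ hu =>
      obtain ⟨G, hG, hGu⟩ := hu
      obtain ⟨g, rfl⟩ := (Phi hx).rangeRestrict_surjective r
      exact ⟨g • G, hG.smul g, fun j => by simp [hGu]⟩
  obtain ⟨G, hG, hGz⟩ := hlift z hmem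
  have hzero : ∀ j, Phi hx (F j - G j) = 0 := fun j => by
    have : Phi hx (G j) = Phi hx (F j) := congrArg Subtype.val (hGz j)
    rw [map_sub, this, sub_self]
  -- Two lifts of the same element of `R` differ by an element of `I`, which has no linear terms.
  have hc : ∀ j l, MvPowerSeries.coeff (Finsupp.single l 1) (F j) =
      MvPowerSeries.coeff (Finsupp.single l 1) (G j) := fun j l => by
    have := coeff_single_eq_zero hx hx0 hdim (hzero j) l
    rwa [map_sub, sub_eq_zero] at this
  refine ⟨fun j => ?_, fun p q => by rw [hc, hc, hG.2]⟩
  have : MvPowerSeries.constantCoeff (F j - G j) = 0 := by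
    rw [← constantCoeff_Phi hx hx0, hzero, map_zero]
  rw [map_sub, hG.1, sub_zero] at this
  exact this

end

/-! ### Logarithmic derivatives and syzygies between two generators -/

section

variable {k : Type*} [Field k]

theorem X_mul_derivative_X_pow_mul (K : ℕ) (h : k⟦X⟧) :
    PowerSeries.X * d⁄dX k (PowerSeries.X ^ K * h) =
      (K : k⟦X⟧) * (PowerSeries.X ^ K * h) + PowerSeries.X ^ (K + 1) * d⁄dX k h := by
  cases K with
  | zero => simp
  | succ K =>
    rw [Derivation.leibniz, PowerSeries.derivative_pow, PowerSeries.derivative_X,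
      Nat.add_sub_cancel, smul_eq_mul, smul_eq_mul]
    ring

theorem X_pow_dvd_X_mul_derivative {K : ℕ} {g : k⟦X⟧} (hg : PowerSeries.X ^ K ∣ g) :
    PowerSeries.X ^ K ∣ PowerSeries.X * d⁄dX k g := by
  obtain ⟨h, rfl⟩ := hg
  rw [X_mul_derivative_X_pow_mul]
  exact dvd_add ((dvd_mul_right _ _).mul_left _)
    ((pow_dvd_pow _ (Nat.le_succ K)).mul_right _)

/-- The operator `t d/dt` kills the constant term and does not lower the order. -/
theorem X_pow_dvd_X_mul_derivative_of_le_unitOrder {o : ℕ} {α : k⟦X⟧}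
    (h : (o : ℕ∞) ≤ unitOrder α) : PowerSeries.X ^ o ∣ PowerSeries.X * d⁄dX k α := by
  have h1 : PowerSeries.X ^ o ∣ α - PowerSeries.C (PowerSeries.constantCoeff α) :=
    PowerSeries.X_pow_dvd_iff.mpr fun m hm =>
      PowerSeries.coeff_of_lt_order m (lt_of_lt_of_le (by exact_mod_cast hm) h)
  simpa using X_pow_dvd_X_mul_derivative h1

variable {n : ℕ}

/-- The unit `β_j` with `t dx_j/dt = t ^ (a_j) β_j`. -/
def logDerivUnit (α : Fin n → k⟦X⟧) (a : Fin n → ℕ) (j : Fin n) : k⟦X⟧ :=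
  (a j : k⟦X⟧) * α j + PowerSeries.X * d⁄dX k (α j)

theorem X_mul_derivative_gen (α : Fin n → k⟦X⟧) (a : Fin n → ℕ) (j : Fin n) :
    PowerSeries.X * d⁄dX k (gen α a j) = PowerSeries.X ^ a j * logDerivUnit α a j := by
  rw [gen, mul_comm (α j), X_mul_derivative_X_pow_mul, logDerivUnit]
  ring

theorem exists_logDerivUnit_mul_eq_one [CharZero k] {α : Fin n → k⟦X⟧} {a : Fin n → ℕ}
    (ha : ∀ j, 0 < a j) (hα : ∀ j, IsUnit (α j)) (j : Fin n) :
    ∃ γ, logDerivUnit α a j * γ = 1 := by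
  have h0 : PowerSeries.constantCoeff (α j) ≠ 0 :=
    ((hα j).map (PowerSeries.constantCoeff (R := k))).ne_zero
  have hu : IsUnit (logDerivUnit α a j) := by
    rw [PowerSeries.isUnit_iff_constantCoeff, logDerivUnit, map_add, map_mul, map_mul,
      map_natCast, PowerSeries.constantCoeff_X, zero_mul, add_zero, isUnit_iff_ne_zero]
    exact mul_ne_zero (Nat.cast_ne_zero.mpr (ha j).ne') h0
  exact hu.exists_right_inv

/-- Every syzygy of the elements `t dx_j/dt` is symmetric to first order. -/
def SyzygiesSymmetric {α : Fin n → k⟦X⟧} {a : Fin n → ℕ}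
    (hx : MvPowerSeries.HasSubst (gen α a)) : Prop :=
  ∀ F : Fin n → MvPowerSeries (Fin n) k,
    ∑ j, Phi hx (F j) * (PowerSeries.X ^ a j * logDerivUnit α a j) = 0 → IsSymmetricSystem F

variable {α : Fin n → k⟦X⟧} {a : Fin n → ℕ} {hx : MvPowerSeries.HasSubst (gen α a)}

theorem syzygiesSymmetric_of_torsion_eq_bot [CharZero k] (ha : ∀ j, 0 < a j)
    (hdim : embDim (curveRing hx) = n) {c : ℕ}
    (hcond : ∀ g : k⟦X⟧, PowerSeries.X ^ c * g ∈ curveRing hx)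
    (htors : Submodule.torsion (curveRing hx) (Omega hx) = ⊥) : SyzygiesSymmetric hx := by
  intro F hF
  refine isSymmetricSystem_of_torsion_eq_bot hx (constantCoeff_gen α a ha) hdim hcond htors ?_
  refine (mul_eq_zero.mp ?_).resolve_left (PowerSeries.X_ne_zero (R := k))
  rw [← hF, Finset.mul_sum]
  refine Finset.sum_congr rfl fun j _ => ?_
  rw [← X_mul_derivative_gen]
  ring

/-- Syzygies between two of the elements. -/
theorem SyzygiesSymmetric.pair (hsym : SyzygiesSymmetric hx) {p q : Fin n} (hpq : p ≠ q)
    {P Q : MvPowerSeries (Fin n) k}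
    (h : Phi hx P * (PowerSeries.X ^ a p * logDerivUnit α a p) +
      Phi hx Q * (PowerSeries.X ^ a q * logDerivUnit α a q) = 0) :
    MvPowerSeries.constantCoeff Q = 0 ∧
      MvPowerSeries.coeff (Finsupp.single q 1) P = MvPowerSeries.coeff (Finsupp.single p 1) Q ∧
      ∀ l, l ≠ p → l ≠ q → MvPowerSeries.coeff (Finsupp.single l 1) Q = 0 := by
  classical
  have hS := hsym (fun j => if j = p then P else if j = q then Q else 0) (by
    rw [← h, ← Finset.add_sum_erase _ _ (Finset.mem_univ p),
      ← Finset.add_sum_erase _ _ (Finset.mem_erase.mpr ⟨hpq.symm, Finset.mem_univ q⟩),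
      Finset.sum_eq_zero]
    · simp [hpq.symm]
    · intro l hl
      simp only [Finset.mem_erase] at hl
      simp [hl.1, hl.2.1])
  refine ⟨?_, ?_, fun l hlp hlq => ?_⟩
  · simpa [hpq.symm] using hS.1 q
  · simpa [hpq.symm] using hS.2 p q
  · simpa [hpq.symm, hlp, hlq] using hS.2 q l

/-- Placing `f` in position `p` and zero elsewhere gives a syzygy; symmetry compares it with the
zero in position `l`. -/
theorem SyzygiesSymmetric.coeff_eq_zero (hsym : SyzygiesSymmetric hx) {p l : Fin n} (hpl : p ≠ l)
    {f : MvPowerSeries (Fin n) k} (hf : Phi hx f = 0) :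
    MvPowerSeries.coeff (Finsupp.single l 1) f = 0 := by
  have h := hsym.pair hpl (P := f) (Q := 0) (by simp [hf])
  simpa using h.2.1

theorem exists_lift_of_X_pow_dvd {c : ℕ}
    (hcond : ∀ g : k⟦X⟧, PowerSeries.X ^ c * g ∈ curveRing hx) {g : k⟦X⟧}
    (hg : PowerSeries.X ^ c ∣ g) : ∃ G, Phi hx G = g := by
  obtain ⟨h, rfl⟩ := hg
  exact hcond h

/-- With `G` in place `q`, the entry needed in place `p` is `-G t^(a_q - a_p) β_q/β_p`. It stays in
the conductor since `a_p < a_q`, so it lifts. The remaining positions of this syzygy are zero, and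
symmetry transfers that to `G`. -/
theorem SyzygiesSymmetric.of_X_pow_dvd [CharZero k] (hsym : SyzygiesSymmetric hx)
    (ha : ∀ j, 0 < a j) (hα : ∀ j, IsUnit (α j)) {c : ℕ}
    (hcond : ∀ g : k⟦X⟧, PowerSeries.X ^ c * g ∈ curveRing hx) {p q : Fin n} (hpq : a p < a q)
    {G : MvPowerSeries (Fin n) k} (hG : PowerSeries.X ^ c ∣ Phi hx G) :
    MvPowerSeries.constantCoeff G = 0 ∧
      ∀ l, l ≠ p → l ≠ q → MvPowerSeries.coeff (Finsupp.single l 1) G = 0 := by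
  obtain ⟨γ, hγ⟩ := exists_logDerivUnit_mul_eq_one ha hα p
  obtain ⟨P, hP⟩ := exists_lift_of_X_pow_dvd hcond
    (hG.mul_right (-(PowerSeries.X ^ (a q - a p) * logDerivUnit α a q * γ)))
  have hne : p ≠ q := fun h => by simp [h] at hpq
  have hX : (PowerSeries.X : k⟦X⟧) ^ a q = PowerSeries.X ^ (a q - a p) * PowerSeries.X ^ a p := by
    rw [← pow_add, Nat.sub_add_cancel hpq.le]
  have h := hsym.pair hne (P := P) (Q := G) (by
    rw [hP, hX]
    linear_combination (-(Phi hx G) * PowerSeries.X ^ (a q - a p) * logDerivUnit α a q *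
      PowerSeries.X ^ a p) * hγ)
  exact ⟨h.1, h.2.2⟩

/-- For at least three generators, conductor elements have no linear terms. -/
theorem SyzygiesSymmetric.coeff_eq_zero_of_three_le [CharZero k] (hsym : SyzygiesSymmetric hx)
    (ha : ∀ j, 0 < a j) (ha_mono : StrictMono a) (hα : ∀ j, IsUnit (α j)) {c : ℕ}
    (hcond : ∀ g : k⟦X⟧, PowerSeries.X ^ c * g ∈ curveRing hx) (hn : 3 ≤ n)
    {G : MvPowerSeries (Fin n) k} (hG : PowerSeries.X ^ c ∣ Phi hx G) (l : Fin n) :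
    MvPowerSeries.coeff (Finsupp.single l 1) G = 0 := by
  -- With three indices there is a pair avoiding `l`.
  obtain ⟨p, q, hpq, hp, hq⟩ : ∃ p q : Fin n, p < q ∧ l ≠ p ∧ l ≠ q := by
    by_cases h0 : l = ⟨0, by omega⟩
    · exact ⟨⟨1, by omega⟩, ⟨2, by omega⟩, by simp, by simp [h0], by simp [h0]⟩
    · by_cases h1 : l = ⟨1, by omega⟩
      · exact ⟨⟨0, by omega⟩, ⟨2, by omega⟩, by simp, h0, by simp [h1]⟩
      · exact ⟨⟨0, by omega⟩, ⟨1, by omega⟩, by simp, h0, h1⟩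
  exact (hsym.of_X_pow_dvd ha hα hcond (ha_mono hpq) hG).2 l hp hq

/-- Elements of order larger than the multiplicity do not involve the first generator. -/
theorem coeff_eq_zero_of_X_pow_succ_dvd (ha : ∀ j, 0 < a j) (hα : ∀ j, IsUnit (α j)) {p : Fin n}
    (hp : ∀ l, l ≠ p → a p < a l) {G : MvPowerSeries (Fin n) k}
    (hG0 : MvPowerSeries.constantCoeff G = 0) (hG : PowerSeries.X ^ (a p + 1) ∣ Phi hx G) :
    MvPowerSeries.coeff (Finsupp.single p 1) G = 0 := by
  classical
  obtain ⟨H, hH⟩ := exists_eq_C_add_sum_X_mul G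
  rw [hG0, map_zero, zero_add] at hH
  have hcoeff : MvPowerSeries.coeff (Finsupp.single p 1) G =
      MvPowerSeries.constantCoeff (H p) := by
    conv_lhs => rw [hH, map_sum, Finset.sum_congr rfl fun l _ => coeff_single_X_mul l p (H l)]
    simp
  have hsum : Phi hx G = ∑ l, gen α a l * Phi hx (H l) := by
    conv_lhs => rw [hH]
    simp
  rw [hsum, ← Finset.add_sum_erase _ _ (Finset.mem_univ p)] at hG
  -- All other generators have order at least `a_p + 1`, so the term of `x_p` must as well, forcing
  -- `H p` to vanish at the origin.
  have h1 : PowerSeries.X ^ (a p + 1) ∣ gen α a p * Phi hx (H p) := by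
    refine (dvd_add_left (Finset.dvd_sum fun l hl => ?_)).mp hG
    refine Dvd.dvd.mul_right ?_ _
    rw [gen]
    exact (pow_dvd_pow _ (hp l (Finset.ne_of_mem_erase hl))).mul_left _
  rw [gen, mul_comm (α p), mul_assoc, pow_succ] at h1
  have h2 := (mul_dvd_mul_iff_left (pow_ne_zero _ (PowerSeries.X_ne_zero (R := k)))).mp h1
  rw [PowerSeries.X_dvd_iff, map_mul] at h2
  have h3 := (mul_eq_zero.mp h2).resolve_left
    ((hα p).map (PowerSeries.constantCoeff (R := k))).ne_zero
  rw [hcoeff, ← constantCoeff_Phi hx (constantCoeff_gen α a ha)]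
  exact h3

end

/-! ### Two generators, and the asymmetric syzygy -/

section

variable {k : Type*} [Field k] [CharZero k]

/-- For two generators, conductor elements do not involve the second generator to first order. -/
theorem SyzygiesSymmetric.coeff_one_eq_zero {α : Fin 2 → k⟦X⟧} {a : Fin 2 → ℕ}
    {hx : MvPowerSeries.HasSubst (gen α a)} (hsym : SyzygiesSymmetric hx)
    (ha : ∀ j, 0 < a j) (ha_mono : StrictMono a) (hα : ∀ j, IsUnit (α j)) {c : ℕ}
    (hcond : ∀ g : k⟦X⟧, PowerSeries.X ^ c * g ∈ curveRing hx)
    {G : MvPowerSeries (Fin 2) k} (hG : PowerSeries.X ^ c ∣ Phi hx G) :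
    MvPowerSeries.coeff (Finsupp.single 1 1) G = 0 := by
  have h01 : a 0 < a 1 := ha_mono (by simp)
  have hconst : ∀ {G : MvPowerSeries (Fin 2) k}, PowerSeries.X ^ c ∣ Phi hx G →
      MvPowerSeries.constantCoeff G = 0 := fun hG => (hsym.of_X_pow_dvd ha hα hcond h01 hG).1
  obtain ⟨γ, hγ⟩ := exists_logDerivUnit_mul_eq_one (a := a) ha hα 0
  -- Descending induction on the order `K`. At `K = 2c` the element is a product of two conductor
  -- elements; their lifts have no constant term, so the product has no linear term.
  have key : ∀ m K, K + m = 2 * c → c ≤ K → ∀ G : MvPowerSeries (Fin 2) k,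
      PowerSeries.X ^ K ∣ Phi hx G → MvPowerSeries.coeff (Finsupp.single 1 1) G = 0 := by
    intro m
    induction m with
    | zero =>
      intro K hK _ G hG
      obtain ⟨h, hh⟩ := hG
      obtain ⟨G₁, hG₁⟩ := exists_lift_of_X_pow_dvd hcond (dvd_refl (PowerSeries.X ^ c))
      obtain ⟨G₂, hG₂⟩ := exists_lift_of_X_pow_dvd hcond (dvd_mul_right (PowerSeries.X ^ c) h)
      have h0 : Phi hx (G - G₁ * G₂) = 0 := by
        rw [map_sub, map_mul, hG₁, hG₂, hh, show K = c + c by omega, pow_add]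
        ring
      have h1 := hsym.coeff_eq_zero (p := 0) (l := 1) (by simp) h0
      rw [map_sub, coeff_single_mul, hconst (G := G₁) (by rw [hG₁]),
        hconst (G := G₂) (by rw [hG₂]; exact dvd_mul_right _ _)] at h1
      simpa using h1
    | succ m ih =>
      intro K hK hcK G hG
      have ih' := ih (K + 1) (by omega) (by omega)
      have hGc : PowerSeries.X ^ c ∣ Phi hx G := (pow_dvd_pow _ hcK).trans hG
      -- Otherwise `x_1` has order at least `K + 1`, and the induction hypothesis would apply to
      -- `X_1` itself.
      have haK : a 0 < K := by
        by_contra hle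
        have h1 := ih' (MvPowerSeries.X 1) (by
          rw [Phi_X, gen]
          exact (pow_dvd_pow _ (by omega)).mul_left _)
        rw [MvPowerSeries.coeff_index_single_self_X] at h1
        exact one_ne_zero h1
      have hG0 : MvPowerSeries.coeff (Finsupp.single 0 1) G = 0 :=
        coeff_eq_zero_of_X_pow_succ_dvd ha hα
          (fun l hl => by rwa [show l = 1 by omega]) (hconst hGc)
          ((pow_dvd_pow _ haK).trans hG)
      -- Here `ρ = x_0 G'/x_0'`, so `x_0 dG - ρ dx_0 = 0` is a syzygy. Its symmetry gives opposite
      -- `X_1`-coefficients for `ρ` and `G`.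
      obtain ⟨ρ, hρ⟩ := exists_lift_of_X_pow_dvd hcond
        ((X_pow_dvd_X_mul_derivative hGc).mul_right (α 0 * γ))
      have hchain : PowerSeries.X * d⁄dX k (Phi hx G) =
          Phi hx (MvPowerSeries.pderiv k 0 G) * (PowerSeries.X ^ a 0 * logDerivUnit α a 0) +
          Phi hx (MvPowerSeries.pderiv k 1 G) * (PowerSeries.X ^ a 1 * logDerivUnit α a 1) := by
        rw [derivative_Phi hx (constantCoeff_gen α a ha), Fin.sum_univ_two,
          ← X_mul_derivative_gen, ← X_mul_derivative_gen]
        ring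
      have hS := hsym.pair (p := 0) (q := 1) (by simp)
        (P := MvPowerSeries.X 0 * MvPowerSeries.pderiv k 0 G - ρ)
        (Q := MvPowerSeries.X 0 * MvPowerSeries.pderiv k 1 G) (by
          rw [map_sub, map_mul, map_mul, Phi_X, hρ, gen]
          linear_combination (-(α 0 * PowerSeries.X ^ a 0)) * hchain -
            (PowerSeries.X * d⁄dX k (Phi hx G) * α 0 * PowerSeries.X ^ a 0) * hγ)
      have h2 : MvPowerSeries.coeff (Finsupp.single 1 1) ρ =
          -MvPowerSeries.coeff (Finsupp.single 1 1) G := by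
        have h3 := hS.2.1
        rw [map_sub, coeff_single_X_mul, coeff_single_X_mul, if_neg (by simp), if_pos rfl,
          ← MvPowerSeries.coeff_zero_eq_constantCoeff_apply, MvPowerSeries.coeff_pderiv] at h3
        simp only [zero_add, Finsupp.coe_zero, Pi.zero_apply, Nat.cast_zero, mul_one,
          zero_sub] at h3
        rw [← h3, neg_neg]
      obtain ⟨h, hh⟩ := hG
      -- The leading term of `ρ` is `K/a_0` times that of `G`, so this combination has order at
      -- least `K + 1`. Combined with `h2`, this gives `(a_0 + K)` times the coefficient equal to
      -- zero.
      have h4 := ih' (MvPowerSeries.C (a 0 : k) * ρ - MvPowerSeries.C (K : k) * G) (by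
        rw [map_sub, map_mul, map_mul, Phi_C, Phi_C, hρ, hh, X_mul_derivative_X_pow_mul,
          map_natCast, map_natCast]
        rw [logDerivUnit] at hγ
        refine ⟨(1 - PowerSeries.X * d⁄dX k (α 0) * γ) * d⁄dX k h -
          d⁄dX k (α 0) * γ * (K : k⟦X⟧) * h, ?_⟩
        rw [pow_succ]
        linear_combination ((K : k⟦X⟧) * (PowerSeries.X ^ K * h) +
          PowerSeries.X ^ K * PowerSeries.X * d⁄dX k h) * hγ)
      rw [map_sub, MvPowerSeries.coeff_C_mul, MvPowerSeries.coeff_C_mul, h2] at h4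
      have h5 : ((a 0 + K : ℕ) : k) * MvPowerSeries.coeff (Finsupp.single 1 1) G = 0 := by
        push_cast
        linear_combination -h4
      exact (mul_eq_zero.mp h5).resolve_left (Nat.cast_ne_zero.mpr (by omega))
  exact key c c (by omega) le_rfl G hG

variable {n : ℕ} {α : Fin n → k⟦X⟧} {a : Fin n → ℕ} {hx : MvPowerSeries.HasSubst (gen α a)}

/-- No two of the units can both have logarithmic derivatives of order at least `o` with
`c ≤ a_p + o`. -/
theorem SyzygiesSymmetric.false_of_X_pow_dvd (hsym : SyzygiesSymmetric hx)
    (ha : ∀ j, 0 < a j) (ha_mono : StrictMono a) (hα : ∀ j, IsUnit (α j)) {c : ℕ}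
    (hcond : ∀ g : k⟦X⟧, PowerSeries.X ^ c * g ∈ curveRing hx) {p q : Fin n} (hpq : p ≠ q)
    {o : ℕ} (ho : c ≤ a p + o) (hp : PowerSeries.X ^ o ∣ PowerSeries.X * d⁄dX k (α p))
    (hq : PowerSeries.X ^ o ∣ PowerSeries.X * d⁄dX k (α q)) : False := by
  obtain ⟨γ, hγ⟩ := exists_logDerivUnit_mul_eq_one (a := a) ha hα q
  -- In `a_q x_q t^(a_p) β_p - a_p x_p t^(a_q) β_q` the terms with `a_p a_q α_p α_q` cancel, leaving
  -- `t^(a_p + a_q) · t W`. Dividing by `t^(a_q) β_q` gives the correction `r`.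
  set W : k⟦X⟧ := (a q : k⟦X⟧) * α q * d⁄dX k (α p) - (a p : k⟦X⟧) * α p * d⁄dX k (α q) with hW
  have hVo : PowerSeries.X ^ o ∣ PowerSeries.X * W := by
    have : PowerSeries.X * W = (a q : k⟦X⟧) * α q * (PowerSeries.X * d⁄dX k (α p)) -
        (a p : k⟦X⟧) * α p * (PowerSeries.X * d⁄dX k (α q)) := by rw [hW]; ring
    rw [this]
    exact dvd_sub (hp.mul_left _) (hq.mul_left _)
  have hrc : PowerSeries.X ^ c ∣ PowerSeries.X ^ a p * (PowerSeries.X * W) * γ := by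
    refine ((pow_dvd_pow _ ho).trans ?_).mul_right _
    rw [pow_add]
    exact mul_dvd_mul_left _ hVo
  obtain ⟨r, hr⟩ := exists_lift_of_X_pow_dvd hcond hrc
  have hS := hsym.pair hpq (P := MvPowerSeries.C (a q : k) * MvPowerSeries.X q)
    (Q := -(MvPowerSeries.C (a p : k) * MvPowerSeries.X p + r)) (by
      rw [map_neg, map_add, map_mul, map_mul, Phi_C, Phi_C, Phi_X, Phi_X, hr, map_natCast,
        map_natCast, gen, gen, hW]
      simp only [logDerivUnit] at hγ ⊢
      linear_combination (-(PowerSeries.X ^ a p * PowerSeries.X * ((a q : k⟦X⟧) * α q *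
        d⁄dX k (α p) - (a p : k⟦X⟧) * α p * d⁄dX k (α q)) * PowerSeries.X ^ a q)) * hγ)
  have hrp : MvPowerSeries.coeff (Finsupp.single p 1) r ≠ 0 := by
    have h := hS.2.1
    rw [MvPowerSeries.coeff_C_mul, map_neg, map_add, MvPowerSeries.coeff_C_mul,
      MvPowerSeries.coeff_index_single_self_X, MvPowerSeries.coeff_index_single_self_X] at h
    intro h0
    rw [h0] at h
    have : ((a q + a p : ℕ) : k) = 0 := by
      push_cast
      linear_combination h
    have := Nat.cast_eq_zero.mp this
    have := ha p
    omega
  apply hrp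
  have hrc' : PowerSeries.X ^ c ∣ Phi hx r := by rw [hr]; exact hrc
  by_cases hn : 3 ≤ n
  · exact hsym.coeff_eq_zero_of_three_le ha ha_mono hα hcond hn hrc' p
  · obtain rfl : n = 2 := by
      have := Fin.val_ne_of_ne hpq
      omega
    by_cases hp0 : p = 0
    · subst hp0
      refine coeff_eq_zero_of_X_pow_succ_dvd (hx := hx) ha hα
        (fun l hl => ha_mono (Fin.pos_of_ne_zero hl))
        (hsym.of_X_pow_dvd ha hα hcond (ha_mono (show (0 : Fin 2) < 1 by simp)) hrc').1 ?_
      -- The factor `t` in `t W` supplies the extra order beyond `a_p`.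
      rw [hr, pow_succ, ← mul_assoc]
      exact ((dvd_mul_right _ _).mul_right _)
    · obtain rfl : p = 1 := by omega
      exact hsym.coeff_one_eq_zero ha ha_mono hα hcond hrc'

end

end AnalyticCurve

end

/-! ### Choice of the pair of indices -/

theorem mainTheorem2 {k : Type*} [Field k] [IsAlgClosed k] [CharZero k]
    (n : ℕ) (hn : 2 ≤ n)
    (a : Fin n → ℕ) (ha : ∀ j, 0 < a j) (ha_mono : StrictMono a)
    (α : Fin n → PowerSeries k) (hα : ∀ j, IsUnit (α j))
    (hedim : AnalyticCurve.embDim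
      (AnalyticCurve.curveRing (AnalyticCurve.hasSubst_gen α a ha)) = n)
    (c : ℕ)
    (hc : AnalyticCurve.conductor (AnalyticCurve.curveRing (AnalyticCurve.hasSubst_gen α a ha)) =
      Ideal.span {(PowerSeries.X : PowerSeries k) ^ c})
    (i d : Fin n)
    (hd : AnalyticCurve.unitOrder (α d) < ⊤)
    (hdi : (c : ℕ∞) ≤ AnalyticCurve.unitOrder (α d) + (a i : ℕ∞))
    (hnorm : ∃ e : Fin n, e ≠ d ∧
      AnalyticCurve.unitOrder (α d) ≤ AnalyticCurve.unitOrder (α e))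
    (h : (AnalyticCurve.unitOrder (α d) ≤ AnalyticCurve.unitOrder (α i) ∧
        AnalyticCurve.unitOrder (α i) < ⊤) ∨ i ≤ d) :
    Submodule.torsion (AnalyticCurve.curveRing (AnalyticCurve.hasSubst_gen α a ha))
      (AnalyticCurve.Omega (AnalyticCurve.hasSubst_gen α a ha)) ≠ ⊥ := by
  intro htors
  have hcond : ∀ g : PowerSeries k, PowerSeries.X ^ c * g ∈
      AnalyticCurve.curveRing (AnalyticCurve.hasSubst_gen α a ha) := by
    have hmem : (PowerSeries.X : PowerSeries k) ^ c ∈ AnalyticCurve.conductor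
        (AnalyticCurve.curveRing (AnalyticCurve.hasSubst_gen α a ha)) := by
      rw [hc]
      exact Ideal.mem_span_singleton_self _
    exact hmem
  have hsym := AnalyticCurve.syzygiesSymmetric_of_torsion_eq_bot ha hedim hcond htors
  -- Truncated subtraction is harmless: `c ≤ a_i + (c - a_i)` always holds.
  have ho : ((c - a i : ℕ) : ℕ∞) ≤ AnalyticCurve.unitOrder (α d) := by
    rw [ENat.natCast_sub]
    exact tsub_le_iff_right.mpr hdi
  have hdvd : ∀ j, AnalyticCurve.unitOrder (α d) ≤ AnalyticCurve.unitOrder (α j) →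
      PowerSeries.X ^ (c - a i) ∣ PowerSeries.X * PowerSeries.derivative k (α j) := fun j hj =>
    AnalyticCurve.X_pow_dvd_X_mul_derivative_of_le_unitOrder (ho.trans hj)
  obtain ⟨e, hed, hde⟩ := hnorm
  -- If `i ≤ d`, then `a_d ≥ a_i` allows the pair `(d, e)`; otherwise the first alternative of `h`
  -- bounds the order of `α_i` and the pair is `(i, d)`.
  by_cases hid : i ≤ d
  · have hle : a i ≤ a d := ha_mono.monotone hid
    exact hsym.false_of_X_pow_dvd ha ha_mono hα hcond hed.symm (o := c - a i) (by omega)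
      (hdvd d le_rfl) (hdvd e hde)
  · exact hsym.false_of_X_pow_dvd ha ha_mono hα hcond (show i ≠ d from fun h' => hid h'.le)
      (o := c - a i) (by omega) (hdvd i (h.resolve_right hid).1) (hdvd d le_rfl)
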